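/- Let $d,N\in\mathbb N$, let $\Omega\subset\mathbb R^d$ be a non-empty, bounded, open set, and let $\Phi\colon\mathbb R^N_+\to[0,\infty)$ be any function, where $\mathbb R^N_+=\{v\in\mathbb R^N: v_i\ge 0 \text{ for all } i\}$. All sets are Lebesgue measurable, $|E|$ is the Lebesgue measure of $E$, the inclusion $E\subset F$ means $|E\setminus F|=0$, and $$\mathrm{Per}(E)=\sup\Big\{\int_E \operatorname{div}\varphi\,dx : \varphi\in C^1_c(\mathbb R^d;\mathbb R^d),\ |\varphi|\le 1\Big\}\in[0,\infty]$$ is the perimeter. The Cheeger constant of $F\subset\mathbb R^d$ is $h(F)=\inf\{\mathrm{Per}(E)/|E| : E\subset F,\ |E|>0\}\in[0,\infty]$. An $N$-set of $\Omega$ is an $N$-tuple $\mathcal E=(\mathcal E_1,\dots,\mathcal E_N)$ with $\mathcal E_i\subset\Omega$, $|\mathcal E_i|>0$ and $|\mathcal E_i\cap\mathcal E_j|=0$ for $i\ne j$; it is an $N$-cluster if moreover $\mathrm{Per}(\mathcal E_i)<\infty$ for all $i$. Put $$H^{\Phi,N}(\Omega)=\inf\Big\{\Phi\Big(\tfrac{\mathrm{Per}(\mathcal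 E_1)}{|\mathcal E_1|},\dots,\tfrac{\mathrm{Per}(\mathcal E_N)}{|\mathcal E_N|}\Big):\mathcal E \text{ is an } N\text{-cluster of }\Omega\Big\},$$ $$\mathscr L^{\Phi,N}_{1,1}(\Omega)=\inf\big\{\Phi\big(h(\mathcal E_1),\dots,h(\mathcal E_N)\big):\mathcal E \text{ is an } N\text{-set of }\Omega\big\},$$ where $\Phi(h(\mathcal E_1),\dots,h(\mathcal E_N))$ is understood as $\infty$ if some $h(\mathcal E_i)=\infty$. A $\Phi$-Cheeger $N$-cluster of $\Omega$ is an $N$-cluster achieving the first infimum; a $(1,\Phi)$-eigen-$N$-cluster of $\Omega$ is an $N$-set achieving the second infimum that is also an $N$-cluster. Then $$\mathscr L^{\Phi,N}_{1,1}(\Omega)\ge H^{\Phi,N}(\Omega).$$ If $\Phi$ is increasing, i.e. $\Phi(v)\le\Phi(w)$ whenever $v,w\in\mathbb R^N_+$ satisfy $v_i\le w_i$ for all $i$, then $$\mathscr L^{\Phi,N}_{1,1}(\Omega)=H^{\Phi,N}(\Omega),$$ and, moreover, every $\Phi$-Cheeger $N$-cluster of $\Omega$ is also a $(1,\Phi)$-eigen-$N$-cluster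 of $\Omega$. -/

import Mathlib

open MeasureTheory
open scoped ENNReal NNReal

noncomputable section

namespace CheegerCluster

/-- The divergence `∑ i, ∂ᵢ φᵢ (x)` of a vector field on `ℝᵈ`. -/
def divergence {d : ℕ} (φ : EuclideanSpace ℝ (Fin d) → EuclideanSpace ℝ (Fin d))
    (x : EuclideanSpace ℝ (Fin d)) : ℝ :=
  ∑ i : Fin d, (fderiv ℝ φ x (EuclideanSpace.single i 1)) i

/-- The (distributional, Euclidean) perimeter `Per(E) ∈ [0, ∞]`: the supremum of `∫_E div φ` over
all `φ ∈ C¹_c(ℝᵈ; ℝᵈ)` with `|φ| ≤ 1`. The field `φ = 0` is admissible, so that truncating the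
integrals at `0` does not change the supremum. -/
def perimeter {d : ℕ} (E : Set (EuclideanSpace ℝ (Fin d))) : ℝ≥0∞ :=
  ⨆ (φ : EuclideanSpace ℝ (Fin d) → EuclideanSpace ℝ (Fin d)) (_ : ContDiff ℝ 1 φ)
    (_ : HasCompactSupport φ) (_ : ∀ x, ‖φ x‖ ≤ 1),
    ENNReal.ofReal (∫ x in E, divergence φ x)

/-- Inclusion `E ⊂ F` in the measure-theoretic sense: `|E \ F| = 0`. -/
def AESubset {d : ℕ} (E F : Set (EuclideanSpace ℝ (Fin d))) : Prop :=
  volume (E \ F) = 0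

/-- The ratio `Per(E) / |E|`. -/
def ratio {d : ℕ} (E : Set (EuclideanSpace ℝ (Fin d))) : ℝ≥0∞ :=
  perimeter E / volume E

/-- The Cheeger constant `h(F) = inf {Per(E) / |E| : E ⊂ F, |E| > 0} ∈ [0, ∞]`, over Lebesgue
measurable sets `E`. -/
def cheeger {d : ℕ} (F : Set (EuclideanSpace ℝ (Fin d))) : ℝ≥0∞ :=
  ⨅ (E : Set (EuclideanSpace ℝ (Fin d))) (_ : NullMeasurableSet E volume) (_ : AESubset E F)
    (_ : 0 < volume E), ratio E

/-- `N`-sets of `F`: `N`-tuples of Lebesgue measurable subsets of `F` of positive measure with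
pairwise negligible intersections. -/
structure IsNSet {d N : ℕ} (F : Set (EuclideanSpace ℝ (Fin d)))
    (E : Fin N → Set (EuclideanSpace ℝ (Fin d))) : Prop where
  measurable : ∀ i, NullMeasurableSet (E i) volume
  subset : ∀ i, AESubset (E i) F
  pos : ∀ i, 0 < volume (E i)
  disjoint : ∀ i j, i ≠ j → volume (E i ∩ E j) = 0

/-- `N`-clusters of `F`: `N`-sets of `F` whose chambers have finite perimeter. -/
structure IsNCluster {d N : ℕ} (F : Set (EuclideanSpace ℝ (Fin d)))
    (E : Fin N → Set (EuclideanSpace ℝ (Fin d))) : Prop extends IsNSet F E where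
  finite : ∀ i, perimeter (E i) < ∞

open Classical in
/-- The value of a reference function `Φ : ℝ^N_+ → [0, ∞)` at a vector with entries in `[0, ∞]`:
it is `Φ v` if all the entries are finite, and `∞` otherwise, so that only vectors in `ℝ^N_+`
compete in an infimum. -/
def evalRef {N : ℕ} (Φ : (Fin N → ℝ≥0) → ℝ≥0) (v : Fin N → ℝ≥0∞) : ℝ≥0∞ :=
  if ∀ i, v i ≠ ∞ then (Φ (fun i => (v i).toNNReal) : ℝ≥0∞) else ∞

/-- The `(Φ, N)`-Cheeger constant `H^{Φ,N}(F) ∈ [0, ∞]`. -/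
def cheegerConst {d N : ℕ} (Φ : (Fin N → ℝ≥0) → ℝ≥0)
    (F : Set (EuclideanSpace ℝ (Fin d))) : ℝ≥0∞ :=
  ⨅ (E : Fin N → Set (EuclideanSpace ℝ (Fin d))) (_ : IsNCluster F E),
    evalRef Φ (fun i => ratio (E i))

/-- The first `1`-geometric `(Φ, N)`-eigenvalue `𝓛^{Φ,N}_{1,1}(F) ∈ [0, ∞]`. -/
def geomEigenvalue {d N : ℕ} (Φ : (Fin N → ℝ≥0) → ℝ≥0)
    (F : Set (EuclideanSpace ℝ (Fin d))) : ℝ≥0∞ :=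
  ⨅ (E : Fin N → Set (EuclideanSpace ℝ (Fin d))) (_ : IsNSet F E),
    evalRef Φ (fun i => cheeger (E i))

/-- `Φ`-Cheeger `N`-clusters of `F`: `N`-clusters achieving the infimum `H^{Φ,N}(F)`. -/
def IsCheegerNCluster {d N : ℕ} (Φ : (Fin N → ℝ≥0) → ℝ≥0)
    (F : Set (EuclideanSpace ℝ (Fin d))) (E : Fin N → Set (EuclideanSpace ℝ (Fin d))) : Prop :=
  IsNCluster F E ∧ evalRef Φ (fun i => ratio (E i)) = cheegerConst Φ F

/-- `(1, Φ)`-eigen-`N`-sets of `F`: `N`-sets achieving the infimum `𝓛^{Φ,N}_{1,1}(F)`. -/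
def IsEigenNSet {d N : ℕ} (Φ : (Fin N → ℝ≥0) → ℝ≥0)
    (F : Set (EuclideanSpace ℝ (Fin d))) (E : Fin N → Set (EuclideanSpace ℝ (Fin d))) : Prop :=
  IsNSet F E ∧ evalRef Φ (fun i => cheeger (E i)) = geomEigenvalue Φ F

/-- `(1, Φ)`-eigen-`N`-clusters of `F`: `(1, Φ)`-eigen-`N`-sets that are `N`-clusters. -/
def IsEigenNCluster {d N : ℕ} (Φ : (Fin N → ℝ≥0) → ℝ≥0)
    (F : Set (EuclideanSpace ℝ (Fin d))) (E : Fin N → Set (EuclideanSpace ℝ (Fin d))) : Prop :=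
  IsEigenNSet Φ F E ∧ IsNCluster F E

end CheegerCluster

end

namespace CheegerCluster

open Set Filter Topology

variable {d N : ℕ}

/-! Since `Φ` is arbitrary in the first inequality, near-minimisers of `Per/|·|` are of no use: each
chamber of an `N`-set must be replaced by a subset whose ratio equals its Cheeger constant exactly.
Subsets of disjoint chambers remain disjoint, so these Cheeger sets form an `N`-cluster with the
same argument of `Φ`. For monotone `Φ` the converse is the trivial bound `h(E) ≤ Per(E)/|E|`, and a
minimising cluster is caught between the two infima.

The substance is therefore `exists_ratio_eq_cheeger`, proved by the direct method from the
variational definition of perimeter. The basic estimate is `|(E - v) ∆ E| ≤ |v| Per(E)`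
(`volume_symmDiff_translate_le`), which puts indicators within `δ Per` in `L¹` of their averages
over `δ`-balls. It has two uses. A set much smaller than a `δ`-ball satisfies `|A| ≤ 2δ Per(A)`, so
volumes of a minimising sequence cannot tend to zero; and averages of a weakly `L²`-convergent
sequence converge pointwise, so bounded perimeter gives compactness in measure
(`exists_subseq_cauchy`). Lower semicontinuity of perimeter, field by field, concludes. -/

/-! ### Divergence and admissible fields -/

lemma divergence_const_smul {φ : EuclideanSpace ℝ (Fin d) → EuclideanSpace ℝ (Fin d)}
    (hφ : Differentiable ℝ φ) (c : ℝ) (x : EuclideanSpace ℝ (Fin d)) :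
    divergence (fun y => c • φ y) x = c * divergence φ x := by
  simp only [divergence, Finset.mul_sum]
  refine Finset.sum_congr rfl fun i _ => ?_
  rw [fderiv_fun_const_smul (hφ x)]
  simp

/-- The divergence of a scalar function times a constant vector is a directional derivative. -/
lemma divergence_smul_const {f : EuclideanSpace ℝ (Fin d) → ℝ} (hf : Differentiable ℝ f)
    (v x : EuclideanSpace ℝ (Fin d)) :
    divergence (fun y => f y • v) x = fderiv ℝ f x v := by
  have hv : v = ∑ i, v i • EuclideanSpace.single i (1 : ℝ) := by
    have := (EuclideanSpace.basisFun (Fin d) ℝ).sum_repr v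
    simpa using this.symm
  conv_rhs => rw [hv]
  simp only [divergence, map_sum, map_smul]
  refine Finset.sum_congr rfl fun i _ => ?_
  rw [fderiv_smul_const (hf x)]
  simp [mul_comm]

lemma continuous_divergence {φ : EuclideanSpace ℝ (Fin d) → EuclideanSpace ℝ (Fin d)}
    (hφ : ContDiff ℝ 1 φ) : Continuous (divergence φ) := by
  have h : Continuous (fderiv ℝ φ) := hφ.continuous_fderiv one_ne_zero
  unfold divergence
  fun_prop

lemma hasCompactSupport_divergence {φ : EuclideanSpace ℝ (Fin d) → EuclideanSpace ℝ (Fin d)}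
    (hφ : HasCompactSupport φ) : HasCompactSupport (divergence φ) := by
  refine (hφ.fderiv (𝕜 := ℝ)).mono fun x hx => ?_
  contrapose! hx
  simp only [Function.mem_support, not_not] at hx
  simp [divergence, hx]

/-- Homogeneity: `c⁻¹ φ` is admissible in the definition of the perimeter. -/
lemma setIntegral_divergence_le {E : Set (EuclideanSpace ℝ (Fin d))} (hE : perimeter E ≠ ∞)
    {φ : EuclideanSpace ℝ (Fin d) → EuclideanSpace ℝ (Fin d)} (hφ : ContDiff ℝ 1 φ)
    (hs : HasCompactSupport φ) {c : ℝ} (hc : 0 < c) (hb : ∀ x, ‖φ x‖ ≤ c) :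
    ∫ x in E, divergence φ x ≤ c * (perimeter E).toReal := by
  have h : ENNReal.ofReal (∫ x in E, divergence (fun y => c⁻¹ • φ y) x) ≤ perimeter E := by
    unfold perimeter
    refine le_iSup_of_le (fun y => c⁻¹ • φ y) (le_iSup_of_le (hφ.const_smul _)
      (le_iSup_of_le (hs.smul_left (f := fun _ => c⁻¹)) (le_iSup_of_le (fun x => ?_) le_rfl)))
    rw [norm_smul, norm_inv, Real.norm_of_nonneg hc.le, inv_mul_le_iff₀ hc, mul_one]
    exact hb x
  rw [ENNReal.ofReal_le_iff_le_toReal hE] at h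
  simp only [divergence_const_smul (hφ.differentiable one_ne_zero), integral_const_mul] at h
  rwa [inv_mul_le_iff₀ hc] at h

/-! ### The translation estimate -/

/-- A set of finite perimeter, tested against a difference quotient. -/
lemma setIntegral_sub_translate_le {E : Set (EuclideanSpace ℝ (Fin d))} (hfin : volume E ≠ ∞)
    (hE : perimeter E ≠ ∞) {ψ : EuclideanSpace ℝ (Fin d) → ℝ} (hψ : ContDiff ℝ 1 ψ)
    (hs : HasCompactSupport ψ) (hb : ∀ x, |ψ x| ≤ 1) (v : EuclideanSpace ℝ (Fin d)) :
    (∫ x in E, ψ (x + v)) - ∫ x in E, ψ x ≤ ‖v‖ * (perimeter E).toReal := by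
  rcases eq_or_ne v 0 with rfl | hv
  · simp
  have : IsFiniteMeasure (volume.restrict E) := ⟨by simpa using hfin.lt_top⟩
  have hDψ : Continuous (fderiv ℝ ψ) := hψ.continuous_fderiv one_ne_zero
  obtain ⟨C, hC⟩ := (hs.fderiv (𝕜 := ℝ)).exists_bound_of_continuous hDψ
  -- Differentiation under the integral along the segment from `x` to `x + v`; the derivative is
  -- dominated by a constant, integrable because `|E| < ∞`.
  have hd : ∀ t : ℝ, HasDerivAt (fun t : ℝ => ∫ x in E, ψ (x + t • v))
      (∫ x in E, fderiv ℝ ψ (x + t • v) v) t := by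
    intro t
    have hint : Integrable (fun x => ψ (x + t • v)) (volume.restrict E) := by
      refine Integrable.of_bound (C := 1) ?_ (ae_of_all _ fun x => ?_)
      · exact (hψ.continuous.comp (continuous_id.add continuous_const)).aestronglyMeasurable
      · simpa using hb _
    refine (hasDerivAt_integral_of_dominated_loc_of_deriv_le (s := univ)
      (bound := fun _ => C * ‖v‖) (F' := fun t x => fderiv ℝ ψ (x + t • v) v)
      univ_mem (Eventually.of_forall fun t => ?_) hint ?_ ?_ (integrable_const _) ?_).2
    · exact (hψ.continuous.comp (continuous_id.add continuous_const)).aestronglyMeasurable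
    · have : Continuous fun x => fderiv ℝ ψ (x + t • v) v := by fun_prop
      exact this.aestronglyMeasurable
    · exact ae_of_all _ fun x t _ =>
        ((fderiv ℝ ψ (x + t • v)).le_opNorm v).trans (by gcongr; exact hC _)
    · refine ae_of_all _ fun x t _ => ?_
      have h1 : HasDerivAt (fun t : ℝ => x + t • v) v t := by
        simpa using ((hasDerivAt_id t).smul_const v).const_add x
      exact ((hψ.differentiable one_ne_zero (x + t • v)).hasFDerivAt.comp_hasDerivAt t h1)
  have hle : ∀ t : ℝ, deriv (fun t : ℝ => ∫ x in E, ψ (x + t • v)) t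
      ≤ ‖v‖ * (perimeter E).toReal := by
    intro t
    rw [(hd t).deriv]
    have hψt : ContDiff ℝ 1 fun x => ψ (x + t • v) := hψ.comp (contDiff_id.add contDiff_const)
    have hst : HasCompactSupport fun x => ψ (x + t • v) :=
      hs.comp_homeomorph (Homeomorph.addRight (t • v))
    -- The derivative at `t` is the integral over `E` of the divergence of `ψ(· + t v) v`, a field
    -- bounded by `‖v‖`.
    have := setIntegral_divergence_le hE (φ := fun x => ψ (x + t • v) • v)
      (hψt.smul contDiff_const) (hst.smul_right (f' := fun _ => v)) (norm_pos_iff.2 hv) fun x => by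
        rw [norm_smul]
        exact mul_le_of_le_one_left (norm_nonneg _) (hb _)
    refine le_of_eq_of_le (integral_congr_ae (ae_of_all _ fun x => ?_)) this
    simp only
    rw [divergence_smul_const (hψt.differentiable one_ne_zero), fderiv_comp_add_right]
  have := image_sub_le_mul_sub_of_deriv_le (fun t => (hd t).differentiableAt) hle zero_le_one
  simpa using this

/-- Smooth compactly supported functions separate disjoint compact sets. -/
lemma exists_contDiff_one_neg_one {K L : Set (EuclideanSpace ℝ (Fin d))} (hK : IsCompact K)
    (hL : IsCompact L) (hd : Disjoint K L) :
    ∃ ψ : EuclideanSpace ℝ (Fin d) → ℝ, ContDiff ℝ 1 ψ ∧ HasCompactSupport ψ ∧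
      (∀ x, |ψ x| ≤ 1) ∧ (∀ x ∈ K, ψ x = 1) ∧ ∀ x ∈ L, ψ x = -1 := by
  have key : ∀ K L : Set (EuclideanSpace ℝ (Fin d)), IsCompact K → IsCompact L → Disjoint K L →
      ∃ f : EuclideanSpace ℝ (Fin d) → ℝ, ContDiff ℝ 1 f ∧ HasCompactSupport f ∧
        (∀ x, f x ∈ Icc (0 : ℝ) 1) ∧ (∀ x ∈ K, f x = 1) ∧ ∀ x ∈ L, f x = 0 := by
    intro K L hK hL hd
    -- Prescribing zero off the unit thickening of `K` as well forces compact support.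
    obtain ⟨f, hf0, hf1, hf⟩ := exists_contMDiffMap_zero_one_of_isClosed (n := 1)
      (modelWithCornersSelf ℝ (EuclideanSpace ℝ (Fin d)))
      (s := (Metric.thickening 1 K)ᶜ ∪ L) (t := K)
      (Metric.isOpen_thickening.isClosed_compl.union hL.isClosed) hK.isClosed
      (disjoint_union_left.2
        ⟨disjoint_compl_left_iff_subset.2 (Metric.self_subset_thickening one_pos K), hd.symm⟩)
    refine ⟨f, f.contMDiff.contDiff, ?_, hf, fun x hx => hf1 hx, fun x hx => hf0 (Or.inr hx)⟩
    refine HasCompactSupport.of_support_subset_isCompact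
      (hK.isBounded.thickening (δ := 1)).isCompact_closure fun x hx => subset_closure ?_
    by_contra h
    exact hx (hf0 (Or.inl h))
  obtain ⟨f, hf, hfs, hfb, hfK, hfL⟩ := key K L hK hL hd
  obtain ⟨g, hg, hgs, hgb, hgL, hgK⟩ := key L K hL hK hd.symm
  refine ⟨fun x => f x - g x, hf.sub hg, hfs.sub hgs, fun x => ?_, fun x hx => ?_, fun x hx => ?_⟩
  · have h1 := hfb x
    have h2 := hgb x
    rw [abs_le]
    constructor <;> linarith [h1.1, h1.2, h2.1, h2.2]
  · simp [hfK x hx, hgK x hx]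
  · simp [hfL x hx, hgL x hx]

/-- Testing against bounded functions that are `1` on most of `P` recovers the measure of `P`. -/
lemma le_setIntegral_of_eq_one {P K : Set (EuclideanSpace ℝ (Fin d))} (hP : volume P ≠ ∞)
    (hK : MeasurableSet K) (hKP : K ⊆ P) {ε : ℝ} (hε : volume.real (P \ K) ≤ ε)
    {ψ : EuclideanSpace ℝ (Fin d) → ℝ} (hψ : Continuous ψ) (hb : ∀ x, |ψ x| ≤ 1)
    (h1 : ∀ x ∈ K, ψ x = 1) :
    volume.real P - 2 * ε ≤ ∫ x in P, ψ x := by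
  have : IsFiniteMeasure (volume.restrict P) := ⟨by simpa using hP.lt_top⟩
  have hint : IntegrableOn ψ P volume :=
    Integrable.of_bound (C := 1) hψ.aestronglyMeasurable (ae_of_all _ fun x => by simpa using hb x)
  have hPK : volume (P \ K) < ∞ := (measure_mono sdiff_subset).trans_lt hP.lt_top
  rw [← integral_inter_add_sdiff hK hint, inter_eq_self_of_subset_right hKP,
    setIntegral_congr_fun hK h1]
  -- One `ε` is lost because `ψ` may be `-1` on `P \ K`, the other in passing from `|K|` to `|P|`.
  have h2 : ‖∫ x in P \ K, ψ x‖ ≤ 1 * volume.real (P \ K) :=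
    norm_setIntegral_le_of_norm_le_const hPK fun x _ => by simpa using hb x
  have h3 : volume.real P = volume.real K + volume.real (P \ K) := by
    rw [← measureReal_inter_add_sdiff hK hP, inter_eq_self_of_subset_right hKP]
  rw [Real.norm_eq_abs, abs_le] at h2
  simp only [integral_const, MeasurableSet.univ, measureReal_restrict_apply, univ_inter,
    smul_eq_mul, mul_one]
  linarith [h2.1]

/-- The `L¹` modulus of continuity of the indicator of a set of finite perimeter. -/
lemma volume_symmDiff_translate_le {E : Set (EuclideanSpace ℝ (Fin d))} (hm : MeasurableSet E)
    (hfin : volume E ≠ ∞) (hE : perimeter E ≠ ∞) (v : EuclideanSpace ℝ (Fin d)) :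
    volume (symmDiff ((fun x => x + v) ⁻¹' E) E) ≤ ENNReal.ofReal ‖v‖ * perimeter E := by
  set F := (fun x => x + v) ⁻¹' E with hF
  have hFm : MeasurableSet F := measurable_add_const v hm
  have hFfin : volume F ≠ ∞ := by rwa [hF, measure_preimage_add_right]
  have hP : volume (F \ E) ≠ ∞ := measure_ne_top_of_subset sdiff_subset hFfin
  have hQ : volume (E \ F) ≠ ∞ := measure_ne_top_of_subset sdiff_subset hfin
  suffices h : volume.real (F \ E) + volume.real (E \ F) ≤ ‖v‖ * (perimeter E).toReal by
    rw [← ENNReal.ofReal_toReal hE, ← ENNReal.ofReal_mul (norm_nonneg v)]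
    refine (measure_union_le _ _).trans ?_
    rw [← ofReal_measureReal hP, ← ofReal_measureReal hQ,
      ← ENNReal.ofReal_add measureReal_nonneg measureReal_nonneg]
    exact ENNReal.ofReal_le_ofReal h
  refine le_of_forall_pos_le_add fun ε hε => ?_
  -- Each of the two differences loses twice this amount, hence `ε / 4`.
  have hε' : ENNReal.ofReal (ε / 4) ≠ 0 := by simpa using by linarith
  obtain ⟨K, hKP, hKc, hK⟩ := (hFm.diff hm).exists_isCompact_sdiff_lt hP hε'
  obtain ⟨L, hLQ, hLc, hL⟩ := (hm.diff hFm).exists_isCompact_sdiff_lt hQ hε'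
  have hK' : volume.real ((F \ E) \ K) ≤ ε / 4 :=
    ENNReal.toReal_le_of_le_ofReal (by positivity) hK.le
  have hL' : volume.real ((E \ F) \ L) ≤ ε / 4 :=
    ENNReal.toReal_le_of_le_ofReal (by positivity) hL.le
  obtain ⟨ψ, hψ, hs, hb, h1, h2⟩ := exists_contDiff_one_neg_one hKc hLc
    (disjoint_sdiff_sdiff.mono hKP hLQ)
  have e1 := le_setIntegral_of_eq_one hP hKc.measurableSet hKP hK' hψ.continuous hb h1
  have e2 := le_setIntegral_of_eq_one hQ hLc.measurableSet hLQ hL' hψ.continuous.neg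
    (ψ := fun x => -ψ x) (by simpa using hb) (by simpa [neg_eq_iff_eq_neg] using h2)
  -- Translating by `-v` turns the first integral into `∫_F ψ`. The parts over `E ∩ F` cancel, and
  -- `ψ` is nearly `1` on `F \ E` and `-1` on `E \ F`.
  have e3 := setIntegral_sub_translate_le hfin hE hψ hs hb (-v)
  have e4 : ∫ x in E, ψ (x + -v) = ∫ x in F, ψ x := by
    rw [hF, ← (measurePreserving_add_right volume v).setIntegral_preimage_emb
      (MeasurableEquiv.addRight v).measurableEmbedding (fun x => ψ (x + -v))]
    simp
  have hint : Integrable ψ := hψ.continuous.integrable_of_hasCompactSupport hs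
  have e5 := integral_inter_add_sdiff hm hint.integrableOn (s := F)
  have e6 := integral_inter_add_sdiff hFm hint.integrableOn (s := E)
  rw [inter_comm] at e6
  rw [integral_neg] at e2
  rw [e4, norm_neg] at e3
  linarith

/-! ### Ball averages and a lower bound on perimeter -/

lemma enorm_indicator_sub_indicator {α : Type*} (A B : Set α) (x : α) :
    ‖A.indicator (fun _ => (1 : ℝ)) x - B.indicator (fun _ => (1 : ℝ)) x‖ₑ
      = (symmDiff A B).indicator 1 x := by
  by_cases hA : x ∈ A <;> by_cases hB : x ∈ B <;> simp [hA, hB, mem_symmDiff]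

/-- The average of the indicator of `A` over the ball of radius `δ` around `x`. -/
noncomputable def ballAverage (A : Set (EuclideanSpace ℝ (Fin d))) (δ : ℝ) (x : EuclideanSpace ℝ (Fin d)) : ℝ :=
  (volume.real (Metric.ball (0 : EuclideanSpace ℝ (Fin d)) δ))⁻¹ *
    volume.real (A ∩ Metric.ball x δ)

lemma volume_real_ball_pos {δ : ℝ} (hδ : 0 < δ) :
    0 < volume.real (Metric.ball (0 : EuclideanSpace ℝ (Fin d)) δ) :=
  ENNReal.toReal_pos (Metric.measure_ball_pos _ _ hδ).ne' measure_ball_lt_top.ne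

/-- Moves the dependence on `x` from the domain into the integrand, so that Tonelli and
measurability of parametric integrals apply. -/
lemma volume_real_inter_ball_eq {A : Set (EuclideanSpace ℝ (Fin d))} (hA : MeasurableSet A)
    (δ : ℝ) (x : EuclideanSpace ℝ (Fin d)) :
    volume.real (A ∩ Metric.ball x δ) =
      ∫ h in Metric.ball (0 : EuclideanSpace ℝ (Fin d)) δ,
        A.indicator (fun _ => (1 : ℝ)) (x + h) := by
  have h1 : (fun h => A.indicator (fun _ => (1 : ℝ)) (x + h))
      = ((fun h => x + h) ⁻¹' A).indicator 1 := rfl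
  have hm : MeasurableSet ((fun h => x + h) ⁻¹' A) := measurable_const_add x hA
  rw [h1, integral_indicator_one hm, measureReal_restrict_apply hm, measureReal_def,
    measureReal_def, ← measure_preimage_add volume x (A ∩ Metric.ball x δ), preimage_inter]
  congr 3
  ext h
  simp

/-- The difference is the mean over `‖h‖ < δ` of `f x - f (x + h)`; by Tonelli, the translation
estimate can be averaged over `h`. -/
lemma lintegral_sub_ballAverage_le {A : Set (EuclideanSpace ℝ (Fin d))} (hA : MeasurableSet A)
    (hfin : volume A ≠ ∞) (hP : perimeter A ≠ ∞) {δ : ℝ} (hδ : 0 < δ) :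
    ∫⁻ x, ‖A.indicator (fun _ => (1 : ℝ)) x - ballAverage A δ x‖ₑ
      ≤ ENNReal.ofReal δ * perimeter A := by
  set B := Metric.ball (0 : EuclideanSpace ℝ (Fin d)) δ with hB
  set f : EuclideanSpace ℝ (Fin d) → ℝ := A.indicator (fun _ => (1 : ℝ)) with hf
  have hfm : Measurable f := measurable_const.indicator hA
  have hm : 0 < volume.real B := volume_real_ball_pos hδ
  have hBfin : volume B ≠ ∞ := measure_ball_lt_top.ne
  have : IsFiniteMeasure (volume.restrict B) := ⟨by simpa using hBfin.lt_top⟩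
  have hint : ∀ x, Integrable (fun h => f (x + h)) (volume.restrict B) := fun x => by
    refine Integrable.of_bound (C := 1) (hfm.comp (measurable_const_add x)).aestronglyMeasurable
      (ae_of_all _ fun h => ?_)
    rw [hf, indicator]
    split_ifs <;> simp
  have h1 : ∀ x, ‖f x - ballAverage A δ x‖ₑ
      ≤ ‖(volume.real B)⁻¹‖ₑ * ∫⁻ h in B, ‖f x - f (x + h)‖ₑ := fun x => by
    have : f x - ballAverage A δ x = (volume.real B)⁻¹ * ∫ h in B, (f x - f (x + h)) := by
      rw [integral_sub (integrable_const _) (hint x), ballAverage, volume_real_inter_ball_eq hA]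
      simp only [integral_const, MeasurableSet.univ, measureReal_restrict_apply, univ_inter,
        smul_eq_mul]
      rw [mul_sub, inv_mul_cancel_left₀ hm.ne']
    rw [this, enorm_mul]
    gcongr
    exact enorm_integral_le_lintegral_enorm _
  have h2 : ∀ h ∈ B, ∫⁻ x, ‖f x - f (x + h)‖ₑ ≤ ENNReal.ofReal δ * perimeter A := fun h hh => by
    have e : ∀ x, ‖f x - f (x + h)‖ₑ
        = (symmDiff A ((fun x => x + h) ⁻¹' A)).indicator 1 x := fun x =>
      enorm_indicator_sub_indicator A ((fun x => x + h) ⁻¹' A) x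
    simp only [e]
    rw [lintegral_indicator_one (hA.symmDiff (measurable_add_const h hA)), symmDiff_comm]
    refine (volume_symmDiff_translate_le hA hfin hP h).trans ?_
    gcongr
    exact (mem_ball_zero_iff.1 hh).le
  have hmeas : Measurable (Function.uncurry fun x h => ‖f x - f (x + h)‖ₑ) :=
    ((hfm.comp measurable_fst).sub (hfm.comp (measurable_fst.add measurable_snd))).enorm
  calc ∫⁻ x, ‖f x - ballAverage A δ x‖ₑ
      ≤ ∫⁻ x, ‖(volume.real B)⁻¹‖ₑ * ∫⁻ h in B, ‖f x - f (x + h)‖ₑ := lintegral_mono h1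
    _ = ‖(volume.real B)⁻¹‖ₑ * ∫⁻ h in B, ∫⁻ x, ‖f x - f (x + h)‖ₑ := by
      rw [lintegral_const_mul' _ _ enorm_ne_top, lintegral_lintegral_swap hmeas.aemeasurable]
    _ ≤ ‖(volume.real B)⁻¹‖ₑ * ∫⁻ _h in B, ENNReal.ofReal δ * perimeter A := by
      exact mul_le_mul' le_rfl (setLIntegral_mono measurable_const h2)
    _ = ENNReal.ofReal δ * perimeter A := by
      rw [setLIntegral_const, mul_comm, mul_assoc, Real.enorm_of_nonneg (by positivity),
        ENNReal.ofReal_inv_of_pos hm, ofReal_measureReal hBfin,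
        ENNReal.mul_inv_cancel (Metric.measure_ball_pos _ _ hδ).ne' hBfin, mul_one]

/-- An isoperimetric inequality: sets of small measure have large perimeter. -/
lemma volume_le_mul_perimeter {A : Set (EuclideanSpace ℝ (Fin d))} (hA : MeasurableSet A)
    (hP : perimeter A ≠ ∞) {δ : ℝ} (hδ : 0 < δ)
    (hsmall : volume A ≤ volume (Metric.ball (0 : EuclideanSpace ℝ (Fin d)) δ) / 2) :
    volume A ≤ 2 * ENNReal.ofReal δ * perimeter A := by
  have hBfin : volume (Metric.ball (0 : EuclideanSpace ℝ (Fin d)) δ) ≠ ∞ :=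
    measure_ball_lt_top.ne
  have hfin : volume A ≠ ∞ := ne_top_of_le_ne_top (ENNReal.div_ne_top hBfin two_ne_zero) hsmall
  have hm := volume_real_ball_pos (d := d) hδ
  have hsmall' : volume.real A ≤ volume.real (Metric.ball (0 : EuclideanSpace ℝ (Fin d)) δ) / 2 := by
    have := ENNReal.toReal_mono (ENNReal.div_ne_top hBfin two_ne_zero) hsmall
    simpa [ENNReal.toReal_div, measureReal_def] using this
  -- `A` fills at most half of any `δ`-ball, so on `A` the indicator and its average differ by at
  -- least `1/2`.
  have h1 : ∀ x ∈ A, ENNReal.ofReal (1 / 2)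
      ≤ ‖A.indicator (fun _ => (1 : ℝ)) x - ballAverage A δ x‖ₑ := fun x hx => by
    have h2 : ballAverage A δ x ≤ 1 / 2 := by
      rw [ballAverage, inv_mul_le_iff₀ hm]
      have := measureReal_mono (μ := volume) (inter_subset_left (s := A) (t := Metric.ball x δ)) hfin
      linarith
    rw [indicator_of_mem hx, Real.enorm_of_nonneg (by linarith)]
    exact ENNReal.ofReal_le_ofReal (by linarith)
  have h3 : ENNReal.ofReal (1 / 2) * volume A ≤ ENNReal.ofReal δ * perimeter A := by
    refine le_trans ?_ (lintegral_sub_ballAverage_le hA hfin hP hδ)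
    rw [← setLIntegral_const]
    exact (setLIntegral_mono' hA h1).trans (setLIntegral_le_lintegral _ _)
  have h4 : (2 : ℝ≥0∞) * ENNReal.ofReal (1 / 2) = 1 := by
    rw [← ENNReal.ofReal_ofNat 2, ← ENNReal.ofReal_mul (by norm_num)]
    norm_num
  calc volume A = 2 * (ENNReal.ofReal (1 / 2) * volume A) := by rw [← mul_assoc, h4, one_mul]
    _ ≤ 2 * (ENNReal.ofReal δ * perimeter A) := by gcongr
    _ = _ := by rw [mul_assoc]

/-! ### Compactness in measure -/

/-- Sequences of sets of bounded measure have subsequences whose indicators converge weakly. -/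
lemma exists_subseq_tendsto_inter {A : ℕ → Set (EuclideanSpace ℝ (Fin d))}
    (hA : ∀ n, MeasurableSet (A n)) {Ω : Set (EuclideanSpace ℝ (Fin d))} (hΩ : volume Ω ≠ ∞)
    (hAΩ : ∀ n, A n ⊆ Ω) :
    ∃ s : ℕ → ℕ, StrictMono s ∧ ∀ B : Set (EuclideanSpace ℝ (Fin d)), MeasurableSet B →
      volume B ≠ ∞ → ∃ l, Tendsto (fun n => volume.real (A (s n) ∩ B)) atTop (𝓝 l) := by
  have hfin : ∀ n, volume (A n) ≠ ∞ := fun n => measure_ne_top_of_subset (hAΩ n) hΩ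
  let u : ℕ → Lp ℝ 2 (volume : Measure (EuclideanSpace ℝ (Fin d))) := fun n =>
    indicatorConstLp 2 (hA n) (hfin n) 1
  let T : ℕ → WeakDual ℝ (Lp ℝ 2 (volume : Measure (EuclideanSpace ℝ (Fin d)))) := fun n =>
    StrongDual.toWeakDual (innerSL ℝ (u n))
  have : Fact ((2 : ℝ≥0∞) ≠ ∞) := ⟨by simp⟩
  have hT : ∀ n, T n ∈ WeakDual.toStrongDual ⁻¹' Metric.closedBall
      (0 : StrongDual ℝ (Lp ℝ 2 (volume : Measure (EuclideanSpace ℝ (Fin d)))))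
      (volume.real Ω ^ (1 / (2 : ℝ))) := fun n => by
    change innerSL ℝ (u n) ∈ Metric.closedBall _ _
    rw [mem_closedBall_zero_iff, innerSL_apply_norm, norm_indicatorConstLp (by simp) (by simp)]
    simp only [norm_one, one_mul, ENNReal.toReal_ofNat]
    exact Real.rpow_le_rpow measureReal_nonneg (measureReal_mono (hAΩ n) hΩ) (by norm_num)
  -- Sequential Banach–Alaoglu for the indicators, viewed as functionals on `L²` through the inner
  -- product.
  obtain ⟨L, -, s, hs, hL⟩ := WeakDual.isSeqCompact_closedBall ℝ _ _ _ hT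
  refine ⟨s, hs, fun B hB hBfin => ⟨L (indicatorConstLp 2 hB hBfin 1), ?_⟩⟩
  have h1 := ((WeakDual.eval_continuous (indicatorConstLp 2 hB hBfin (1 : ℝ))).tendsto L).comp hL
  refine h1.congr fun n => ?_
  change inner ℝ (indicatorConstLp 2 (hA (s n)) (hfin (s n)) (1 : ℝ)) _ = _
  rw [L2.inner_indicatorConstLp_one, setIntegral_indicatorConstLp (hA _), inter_comm]
  simp

lemma measurable_ballAverage {A : Set (EuclideanSpace ℝ (Fin d))} (hA : MeasurableSet A) (δ : ℝ) :
    Measurable (ballAverage A δ) := by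
  have hfm : Measurable (A.indicator fun _ => (1 : ℝ)) := measurable_const.indicator hA
  have h : Measurable (Function.uncurry fun x h : EuclideanSpace ℝ (Fin d) =>
      A.indicator (fun _ => (1 : ℝ)) (x + h)) := hfm.comp (measurable_fst.add measurable_snd)
  unfold ballAverage
  simp only [volume_real_inter_ball_eq hA]
  exact (h.stronglyMeasurable.integral_prod_right
    (ν := volume.restrict (Metric.ball 0 δ))).measurable.const_mul _

lemma abs_ballAverage_le_one (A : Set (EuclideanSpace ℝ (Fin d))) {δ : ℝ} (hδ : 0 < δ)
    (x : EuclideanSpace ℝ (Fin d)) : |ballAverage A δ x| ≤ 1 := by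
  have hm := volume_real_ball_pos (d := d) hδ
  rw [ballAverage, abs_of_nonneg (by positivity), inv_mul_le_iff₀ hm, mul_one, measureReal_def,
    measureReal_def, ← Measure.addHaar_ball_center volume x δ]
  exact measureReal_mono inter_subset_right measure_ball_lt_top.ne

/-- Sets of uniformly bounded perimeter in a set of finite measure are precompact in measure. -/
lemma exists_subseq_cauchy {A : ℕ → Set (EuclideanSpace ℝ (Fin d))}
    (hA : ∀ n, MeasurableSet (A n)) {Ω : Set (EuclideanSpace ℝ (Fin d))} (hΩ : volume Ω ≠ ∞)
    (hAΩ : ∀ n, A n ⊆ Ω) {C : ℝ≥0∞} (hC : C ≠ ∞) (hP : ∀ n, perimeter (A n) ≤ C) :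
    ∃ s : ℕ → ℕ, StrictMono s ∧ ∀ ε : ℝ≥0∞, ε ≠ 0 → ∃ N, ∀ n ≥ N, ∀ m ≥ N,
      volume (symmDiff (A (s n)) (A (s m))) ≤ ε := by
  -- The subsequence is fixed before `ε` and the radius `δ`, so no diagonal argument is needed.
  obtain ⟨s, hs, hl⟩ := exists_subseq_tendsto_inter hA hΩ hAΩ
  refine ⟨s, hs, fun ε hε => ?_⟩
  have hε4 : ε / 4 ≠ 0 := (ENNReal.div_pos hε (by simp)).ne'
  obtain ⟨δ, hδ, hδC⟩ : ∃ δ : ℝ, 0 < δ ∧ ENNReal.ofReal δ * C < ε / 4 := by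
    obtain ⟨δ, hδ, h⟩ := ENNReal.exists_nnreal_pos_mul_lt hC hε4
    exact ⟨δ, hδ, by rwa [ENNReal.ofReal_coe_nnreal]⟩
  have hlim : ∀ x, ∃ l, Tendsto (fun n => ballAverage (A (s n)) δ x) atTop (𝓝 l) := fun x => by
    obtain ⟨l, hl⟩ := hl (Metric.ball x δ) measurableSet_ball measure_ball_lt_top.ne
    exact ⟨_, hl.const_mul _⟩
  choose g hg using hlim
  have hgm : Measurable g :=
    measurable_of_tendsto_metrizable (fun n => measurable_ballAverage (hA (s n)) δ)
      (tendsto_pi_nhds.2 hg)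
  have hg1 : ∀ x, |g x| ≤ 1 := fun x =>
    le_of_tendsto (hg x).abs (Eventually.of_forall fun n => abs_ballAverage_le_one _ hδ x)
  -- Dominated convergence on `Ω`: the averages and their limit are bounded by `1`, and `|Ω| < ∞`.
  have hconv : Tendsto (fun n => ∫⁻ x in Ω, ‖ballAverage (A (s n)) δ x - g x‖ₑ) atTop (𝓝 0) := by
    have := tendsto_lintegral_of_dominated_convergence (μ := volume.restrict Ω)
      (F := fun n x => ‖ballAverage (A (s n)) δ x - g x‖ₑ) (f := fun _ => 0) (fun _ => 2)
      (fun n => ((measurable_ballAverage (hA (s n)) δ).sub hgm).enorm)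
      (fun n => ae_of_all _ fun x => ?_) ?_ (ae_of_all _ fun x => ?_)
    · simpa using this
    · beta_reduce
      rw [← ofReal_norm, ← ENNReal.ofReal_ofNat 2]
      refine ENNReal.ofReal_le_ofReal ((norm_sub_le _ _).trans ?_)
      have h1 := abs_ballAverage_le_one (A (s n)) hδ x
      have h2 := hg1 x
      simp only [Real.norm_eq_abs]
      linarith
    · simpa using ENNReal.mul_ne_top (by simp) hΩ
    · have := ((hg x).sub_const (g x)).enorm
      simpa using this
  obtain ⟨N, hN⟩ := eventually_atTop.1 (hconv.eventually (gt_mem_nhds hε4.bot_lt))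
  refine ⟨N, fun n hn m hm => ?_⟩
  have hdist : ∀ k ≥ N, ∫⁻ x in Ω, ‖(A (s k)).indicator (fun _ => (1 : ℝ)) x - g x‖ₑ
      ≤ ε / 4 + ε / 4 := fun k hk => by
    have hP' : perimeter (A (s k)) ≠ ∞ := ne_top_of_le_ne_top hC (hP _)
    calc ∫⁻ x in Ω, ‖(A (s k)).indicator (fun _ => (1 : ℝ)) x - g x‖ₑ
        ≤ ∫⁻ x in Ω, (‖(A (s k)).indicator (fun _ => (1 : ℝ)) x - ballAverage (A (s k)) δ x‖ₑ
            + ‖ballAverage (A (s k)) δ x - g x‖ₑ) := by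
          refine lintegral_mono fun x => ?_
          rw [← sub_add_sub_cancel _ (ballAverage (A (s k)) δ x)]
          exact enorm_add_le _ _
      _ = (∫⁻ x in Ω, ‖(A (s k)).indicator (fun _ => (1 : ℝ)) x - ballAverage (A (s k)) δ x‖ₑ)
            + ∫⁻ x in Ω, ‖ballAverage (A (s k)) δ x - g x‖ₑ :=
          lintegral_add_right _ ((measurable_ballAverage (hA (s k)) δ).sub hgm).enorm
      _ ≤ ε / 4 + ε / 4 := by
          refine add_le_add ?_ (hN k hk).le
          refine (setLIntegral_le_lintegral _ _).trans ((lintegral_sub_ballAverage_le (hA _)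
            (measure_ne_top_of_subset (hAΩ _) hΩ) hP' hδ).trans ?_)
          refine le_trans ?_ hδC.le
          gcongr
          exact hP _
  calc volume (symmDiff (A (s n)) (A (s m)))
      = ∫⁻ x in Ω, ‖(A (s n)).indicator (fun _ => (1 : ℝ)) x
          - (A (s m)).indicator (fun _ => (1 : ℝ)) x‖ₑ := by
        simp only [enorm_indicator_sub_indicator]
        rw [lintegral_indicator_one ((hA _).symmDiff (hA _)),
          Measure.restrict_apply ((hA _).symmDiff (hA _)), inter_eq_left.2]
        exact symmDiff_subset_union.trans (union_subset (hAΩ _) (hAΩ _))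
    _ ≤ ∫⁻ x in Ω, (‖(A (s n)).indicator (fun _ => (1 : ℝ)) x - g x‖ₑ
          + ‖(A (s m)).indicator (fun _ => (1 : ℝ)) x - g x‖ₑ) := by
        refine lintegral_mono fun x => ?_
        rw [← sub_sub_sub_cancel_right _ _ (g x)]
        exact enorm_sub_le
    _ = (∫⁻ x in Ω, ‖(A (s n)).indicator (fun _ => (1 : ℝ)) x - g x‖ₑ)
          + ∫⁻ x in Ω, ‖(A (s m)).indicator (fun _ => (1 : ℝ)) x - g x‖ₑ :=
        lintegral_add_right _ ((measurable_const.indicator (hA _)).sub hgm).enorm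
    _ ≤ (ε / 4 + ε / 4) + (ε / 4 + ε / 4) := add_le_add (hdist n hn) (hdist m hm)
    _ = ε := by
        rw [← two_mul, ← two_mul, ← mul_assoc, show (2 : ℝ≥0∞) * 2 = 4 by norm_num]
        exact ENNReal.mul_div_cancel (by simp) (by simp)

/-- Completeness of the measure algebra. -/
lemma exists_tendsto_symmDiff {α : Type*} [MeasurableSpace α] {μ : Measure α} {A : ℕ → Set α}
    (hA : ∀ n, MeasurableSet (A n))
    (hc : ∀ ε : ℝ≥0∞, ε ≠ 0 → ∃ N, ∀ n ≥ N, ∀ m ≥ N, μ (symmDiff (A n) (A m)) ≤ ε) :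
    ∃ (t : ℕ → ℕ) (E : Set α), StrictMono t ∧ MeasurableSet E ∧
      Tendsto (fun n => μ (symmDiff (A (t n)) E)) atTop (𝓝 0) := by
  have h2 : ∀ n : ℕ, (2⁻¹ : ℝ≥0∞) ^ n ≠ 0 := fun n => pow_ne_zero n (by simp)
  -- Consecutive differences are made summable, as for completeness of `L¹`; the limit is the limsup
  -- set.
  obtain ⟨t, ht, hμ⟩ := extraction_forall_of_eventually'
    (P := fun n k => ∀ m ≥ k, μ (symmDiff (A k) (A m)) ≤ 2⁻¹ ^ n) fun n => by
      obtain ⟨N, hN⟩ := hc _ (h2 n)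
      exact ⟨N, fun k hk m hm => hN k hk m (hk.trans hm)⟩
  refine ⟨t, {x | ∃ᶠ n in atTop, x ∈ A (t n)}, ht, ?_, ?_⟩
  · have := MeasurableSet.measurableSet_limsup fun n => hA (t n)
    convert this using 1
    ext x
    exact mem_limsup_iff_frequently_mem.symm
  have hbound : ∀ n, μ (symmDiff (A (t n)) {x | ∃ᶠ n in atTop, x ∈ A (t n)})
      ≤ 2⁻¹ ^ n * 2 := fun n => by
    -- If `x` avoids every consecutive difference from `n` on, its membership is constant from there
    -- and so agrees with the limsup.
    have hsub : symmDiff (A (t n)) {x | ∃ᶠ n in atTop, x ∈ A (t n)}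
        ⊆ ⋃ k, symmDiff (A (t (n + k))) (A (t (n + k + 1))) := fun x hx => by
      by_contra hcon
      simp only [mem_iUnion, mem_symmDiff, not_exists] at hcon
      have hconst : ∀ k, x ∈ A (t (n + k)) ↔ x ∈ A (t n) := fun k => by
        induction k with
        | zero => rfl
        | succ k ih =>
          have := hcon k
          rw [← add_assoc]
          tauto
      have hE : x ∈ {x | ∃ᶠ n in atTop, x ∈ A (t n)} ↔ x ∈ A (t n) := by
        have hev : ∀ᶠ k in atTop, x ∈ A (t k) ↔ x ∈ A (t n) :=
          eventually_atTop.2 ⟨n, fun k hk => by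
            obtain ⟨j, rfl⟩ := Nat.exists_eq_add_of_le hk
            exact hconst j⟩
        rw [mem_ofPred_eq, frequently_congr hev, frequently_const]
      rw [mem_symmDiff, hE] at hx
      tauto
    calc μ (symmDiff (A (t n)) {x | ∃ᶠ n in atTop, x ∈ A (t n)})
        ≤ ∑' k, μ (symmDiff (A (t (n + k))) (A (t (n + k + 1)))) :=
          (measure_mono hsub).trans (measure_iUnion_le _)
      _ ≤ ∑' k, 2⁻¹ ^ n * (2⁻¹ : ℝ≥0∞) ^ k := ENNReal.tsum_le_tsum fun k => by
          rw [← pow_add]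
          exact hμ (n + k) _ (ht.monotone (Nat.le_succ _))
      _ = 2⁻¹ ^ n * 2 := by
          rw [ENNReal.tsum_mul_left, ENNReal.tsum_geometric, ENNReal.one_sub_inv_two, inv_inv]
  have hlim : Tendsto (fun n : ℕ => (2⁻¹ : ℝ≥0∞) ^ n * 2) atTop (𝓝 0) := by
    have := ENNReal.Tendsto.mul_const (b := 2)
      (ENNReal.tendsto_pow_atTop_nhds_zero_of_lt_one (r := 2⁻¹) (by simp)) (Or.inr (by simp))
    simpa using this
  exact tendsto_of_tendsto_of_tendsto_of_le_of_le tendsto_const_nhds hlim (fun _ => zero_le) hbound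

/-- The integrals differ by at most `M |A n ∆ E|`. Taking `f = 1` gives convergence of volumes, `f =
div φ` semicontinuity of perimeter. -/
lemma tendsto_setIntegral_of_tendsto_symmDiff {A : ℕ → Set (EuclideanSpace ℝ (Fin d))}
    {E : Set (EuclideanSpace ℝ (Fin d))} (hA : ∀ n, MeasurableSet (A n)) (hE : MeasurableSet E)
    (hAfin : ∀ n, volume (A n) ≠ ∞) (hEfin : volume E ≠ ∞)
    (h : Tendsto (fun n => volume (symmDiff (A n) E)) atTop (𝓝 0))
    {f : EuclideanSpace ℝ (Fin d) → ℝ} (hf : Continuous f) {M : ℝ} (hM : ∀ x, |f x| ≤ M) :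
    Tendsto (fun n => ∫ x in A n, f x) atTop (𝓝 (∫ x in E, f x)) := by
  have hint : ∀ S : Set (EuclideanSpace ℝ (Fin d)), volume S ≠ ∞ → IntegrableOn f S volume :=
    fun S hS => Measure.integrableOn_of_bounded (M := M) hS hf.aestronglyMeasurable
      (ae_of_all _ hM)
  rw [tendsto_iff_norm_sub_tendsto_zero]
  have hr : Tendsto (fun n => M * volume.real (symmDiff (A n) E)) atTop (𝓝 0) := by
    have := ((ENNReal.tendsto_toReal ENNReal.zero_ne_top).comp h).const_mul M
    simpa [measureReal_def] using this
  refine squeeze_zero (fun _ => norm_nonneg _) (fun n => ?_) hr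
  have hd1 : volume (A n \ E) ≠ ∞ := measure_ne_top_of_subset sdiff_subset (hAfin n)
  have hd2 : volume (E \ A n) ≠ ∞ := measure_ne_top_of_subset sdiff_subset hEfin
  have e1 := integral_inter_add_sdiff hE (hint _ (hAfin n))
  have e2 := integral_inter_add_sdiff (hA n) (hint _ hEfin)
  rw [inter_comm] at e2
  rw [← e1, ← e2, add_sub_add_left_eq_sub]
  refine (norm_sub_le _ _).trans ?_
  have b1 : ‖∫ x in A n \ E, f x‖ ≤ M * volume.real (A n \ E) :=
    norm_setIntegral_le_of_norm_le_const hd1.lt_top fun x _ => hM x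
  have b2 : ‖∫ x in E \ A n, f x‖ ≤ M * volume.real (E \ A n) :=
    norm_setIntegral_le_of_norm_le_const hd2.lt_top fun x _ => hM x
  have b3 : volume.real (symmDiff (A n) E) = volume.real (A n \ E) + volume.real (E \ A n) :=
    measureReal_union disjoint_sdiff_sdiff (hE.diff (hA n)) hd1 hd2
  rw [b3, mul_add]
  exact add_le_add b1 b2

/-! ### Existence of Cheeger sets -/

lemma perimeter_congr {E F : Set (EuclideanSpace ℝ (Fin d))} (h : E =ᵐ[volume] F) :
    perimeter E = perimeter F := by
  unfold perimeter
  simp only [setIntegral_congr_set h]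

lemma ratio_congr {E F : Set (EuclideanSpace ℝ (Fin d))} (h : E =ᵐ[volume] F) :
    ratio E = ratio F := by
  rw [ratio, ratio, perimeter_congr h, measure_congr h]

lemma cheeger_le_ratio {E F : Set (EuclideanSpace ℝ (Fin d))} (hE : NullMeasurableSet E volume)
    (hEF : AESubset E F) (h0 : 0 < volume E) : cheeger F ≤ ratio E :=
  iInf_le_of_le E (iInf_le_of_le hE (iInf_le_of_le hEF (iInf_le_of_le h0 le_rfl)))

lemma perimeter_eq_ratio_mul {E : Set (EuclideanSpace ℝ (Fin d))} (h0 : volume E ≠ 0)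
    (h1 : volume E ≠ ∞) : perimeter E = ratio E * volume E :=
  (ENNReal.div_mul_cancel h0 h1).symm

/-- The compactness lemmas need measurable sets genuinely contained in `Ω`, whereas competitors are
null measurable and contained only up to null sets. -/
lemma exists_measurable_subset_ae_eq {E F Ω : Set (EuclideanSpace ℝ (Fin d))}
    (hΩ : MeasurableSet Ω) (hFΩ : AESubset F Ω) (hE : NullMeasurableSet E volume)
    (hEF : AESubset E F) : ∃ A ⊆ Ω, MeasurableSet A ∧ A =ᵐ[volume] E := by
  obtain ⟨A, hAE, hA, hAe⟩ := hE.exists_measurable_subset_ae_eq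
  refine ⟨A ∩ Ω, inter_subset_right, hA.inter hΩ, EventuallyEq.trans ?_ hAe⟩
  have h0 : volume (A \ Ω) = 0 := by
    refine measure_mono_null (fun x hx => ?_) (measure_union_null hEF hFΩ)
    by_cases hxF : x ∈ F
    · exact Or.inr ⟨hxF, hx.2⟩
    · exact Or.inl ⟨hAE hx.1, hxF⟩
  exact ae_eq_set.2 ⟨by simp [inter_sdiff_right_comm], by rwa [sdiff_self_inter]⟩

/-- Existence of Cheeger sets: the Cheeger constant is attained when it is finite. -/
theorem exists_ratio_eq_cheeger {F Ω : Set (EuclideanSpace ℝ (Fin d))} (hΩ : MeasurableSet Ω)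
    (hΩfin : volume Ω ≠ ∞) (hFΩ : AESubset F Ω) (hF : cheeger F ≠ ∞) :
    ∃ E, NullMeasurableSet E volume ∧ AESubset E F ∧ 0 < volume E ∧ perimeter E < ∞ ∧
      ratio E = cheeger F := by
  have hseq : ∀ n : ℕ, ∃ A ⊆ Ω, MeasurableSet A ∧ AESubset A F ∧ 0 < volume A ∧
      ratio A < cheeger F + (n + 1 : ℝ≥0∞)⁻¹ := fun n => by
    have hlt : cheeger F < cheeger F + (n + 1 : ℝ≥0∞)⁻¹ :=
      ENNReal.lt_add_right hF (by simp)
    conv_lhs at hlt => unfold cheeger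
    simp only [iInf_lt_iff] at hlt
    obtain ⟨E, hE, hEF, h0, hr⟩ := hlt
    obtain ⟨A, hAΩ, hA, hAE⟩ := exists_measurable_subset_ae_eq hΩ hFΩ hE hEF
    refine ⟨A, hAΩ, hA, ?_, by rwa [measure_congr hAE], by rwa [ratio_congr hAE]⟩
    rw [AESubset, measure_congr (hAE.diff (ae_eq_refl F))]
    exact hEF
  choose A hAΩ hA hAF hA0 hAr using hseq
  have hAfin : ∀ n, volume (A n) ≠ ∞ := fun n => measure_ne_top_of_subset (hAΩ n) hΩfin
  have hr1 : ∀ n, ratio (A n) ≤ cheeger F + 1 := fun n =>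
    (hAr n).le.trans (by gcongr; simp [ENNReal.inv_le_one])
  have hh1 : cheeger F + 1 ≠ ∞ := by simpa using hF
  have hper : ∀ n, perimeter (A n) = ratio (A n) * volume (A n) := fun n =>
    perimeter_eq_ratio_mul (hA0 n).ne' (hAfin n)
  have hP : ∀ n, perimeter (A n) ≤ (cheeger F + 1) * volume Ω := fun n => by
    rw [hper]
    exact mul_le_mul' (hr1 n) (measure_mono (hAΩ n))
  have hC : (cheeger F + 1) * volume Ω ≠ ∞ := ENNReal.mul_ne_top hh1 hΩfin
  -- With `2δ(h + 1) < 1`, a volume below half that of the `δ`-ball would give `|A n| ≤ 2δ Per(A n)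
  -- ≤ 2δ(h + 1)|A n| < |A n|`.
  obtain ⟨c, hc0, hc⟩ : ∃ c : ℝ≥0∞, 0 < c ∧ ∀ n, c ≤ volume (A n) := by
    obtain ⟨δ, hδ, hδh⟩ :
        ∃ δ : ℝ, 0 < δ ∧ ENNReal.ofReal δ * (2 * (cheeger F + 1)) < 1 := by
      obtain ⟨δ, hδ, h⟩ := ENNReal.exists_nnreal_pos_mul_lt
        (ENNReal.mul_ne_top ENNReal.ofNat_ne_top hh1 : 2 * (cheeger F + 1) ≠ ∞) one_ne_zero
      exact ⟨δ, hδ, by rwa [ENNReal.ofReal_coe_nnreal]⟩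
    refine ⟨volume (Metric.ball (0 : EuclideanSpace ℝ (Fin d)) δ) / 2,
      ENNReal.div_pos (Metric.measure_ball_pos _ _ hδ).ne' (by simp), fun n => ?_⟩
    by_contra! hlt
    have h := volume_le_mul_perimeter (hA n) (ne_top_of_le_ne_top hC (hP n)) hδ hlt.le
    rw [hper] at h
    have h' : volume (A n) < 1 * volume (A n) := by
      refine lt_of_le_of_lt ?_ (ENNReal.mul_lt_mul_left (hA0 n).ne' (hAfin n) hδh)
      refine h.trans ?_
      calc 2 * ENNReal.ofReal δ * (ratio (A n) * volume (A n))
          ≤ 2 * ENNReal.ofReal δ * ((cheeger F + 1) * volume (A n)) := by gcongr; exact hr1 n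
        _ = ENNReal.ofReal δ * (2 * (cheeger F + 1)) * volume (A n) := by ring
    simp at h'
  obtain ⟨s, hs, hcauchy⟩ := exists_subseq_cauchy hA hΩfin hAΩ hC hP
  obtain ⟨t, E, ht, hE, hlim⟩ := exists_tendsto_symmDiff (fun n => hA (s n)) hcauchy
  have hEF : AESubset E F := by
    have hle : ∀ n, volume (E \ F) ≤ volume (symmDiff (A (s (t n))) E) := fun n => by
      calc volume (E \ F) ≤ volume (symmDiff (A (s (t n))) E ∪ A (s (t n)) \ F) := by
            refine measure_mono fun x hx => ?_
            by_cases hxA : x ∈ A (s (t n))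
            · exact Or.inr ⟨hxA, hx.2⟩
            · exact Or.inl (Or.inr ⟨hx.1, hxA⟩)
        _ ≤ volume (symmDiff (A (s (t n))) E) + volume (A (s (t n)) \ F) := measure_union_le _ _
        _ = volume (symmDiff (A (s (t n))) E) := by rw [hAF, add_zero]
    exact le_antisymm (ge_of_tendsto' hlim hle) zero_le
  have hEfin : volume E ≠ ∞ := by
    have : volume E ≤ volume (E \ F) + volume (F \ Ω) + volume Ω := by
      refine (measure_mono fun x hx => ?_).trans
        ((measure_union_le _ _).trans (add_le_add (measure_union_le (E \ F) (F \ Ω)) le_rfl))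
      by_cases hxF : x ∈ F <;> by_cases hxΩ : x ∈ Ω <;> simp [hx, hxF, hxΩ]
    rw [hEF, hFΩ, zero_add, zero_add] at this
    exact ne_top_of_le_ne_top hΩfin this
  have hconv : ∀ {f : EuclideanSpace ℝ (Fin d) → ℝ}, Continuous f → ∀ {M : ℝ}, (∀ x, |f x| ≤ M) →
      Tendsto (fun n => ∫ x in A (s (t n)), f x) atTop (𝓝 (∫ x in E, f x)) := fun hf _ hM =>
    tendsto_setIntegral_of_tendsto_symmDiff (fun n => hA _) hE (fun n => hAfin _) hEfin hlim hf hM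
  have hvol : Tendsto (fun n => volume (A (s (t n)))) atTop (𝓝 (volume E)) := by
    have h := hconv (f := fun _ => 1) continuous_const (M := 1) (by simp)
    simp only [integral_const, MeasurableSet.univ, measureReal_restrict_apply, univ_inter,
      smul_eq_mul, mul_one] at h
    have := (ENNReal.continuous_ofReal.tendsto _).comp h
    simpa only [Function.comp_def, ofReal_measureReal (hAfin _), ofReal_measureReal hEfin] using this
  have hE0 : 0 < volume E := hc0.trans_le (ge_of_tendsto' hvol fun n => hc _)
  have hrlim : Tendsto (fun n => (cheeger F + ((s (t n) : ℕ) + 1 : ℝ≥0∞)⁻¹) * volume (A (s (t n))))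
      atTop (𝓝 (cheeger F * volume E)) := by
    have h1 : Tendsto (fun n : ℕ => ((n : ℝ≥0∞) + 1)⁻¹) atTop (𝓝 0) := by
      have := ENNReal.tendsto_inv_nat_nhds_zero.comp (tendsto_add_atTop_nat 1)
      simpa [Function.comp_def] using this
    have h2 := (h1.comp (hs.comp ht).tendsto_atTop).const_add (cheeger F)
    rw [add_zero] at h2
    exact ENNReal.Tendsto.mul h2 (Or.inr hEfin) hvol (Or.inr hF)
  -- Lower semicontinuity: for each fixed field the integrals over the sequence converge, and they
  -- are bounded by perimeters at most `(h + o(1))|A n|`.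
  have hPE : perimeter E ≤ cheeger F * volume E := by
    refine iSup_le fun φ => iSup_le fun hφ => iSup_le fun hφs => iSup_le fun hφb => ?_
    obtain ⟨M, hM⟩ := (hasCompactSupport_divergence hφs).exists_bound_of_continuous
      (continuous_divergence hφ)
    refine le_of_tendsto_of_tendsto' ((ENNReal.continuous_ofReal.tendsto _).comp
      (hconv (continuous_divergence hφ) hM)) hrlim fun n => ?_
    calc ENNReal.ofReal (∫ x in A (s (t n)), divergence φ x) ≤ perimeter (A (s (t n))) :=
          le_iSup_of_le φ (le_iSup_of_le hφ (le_iSup_of_le hφs (le_iSup_of_le hφb le_rfl)))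
      _ ≤ _ := by
          rw [hper]
          gcongr
          exact (hAr _).le
  exact ⟨E, hE.nullMeasurableSet, hEF, hE0, hPE.trans_lt (ENNReal.mul_lt_top hF.lt_top hEfin.lt_top),
    le_antisymm (ENNReal.div_le_of_le_mul hPE) (cheeger_le_ratio hE.nullMeasurableSet hEF hE0)⟩

/-! ### Comparison of the two infima -/

lemma AESubset.trans {E F G : Set (EuclideanSpace ℝ (Fin d))} (h1 : AESubset E F)
    (h2 : AESubset F G) : AESubset E G := by
  refine measure_mono_null (fun x hx => ?_) (measure_union_null h1 h2)
  by_cases hxF : x ∈ F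
  · exact Or.inr ⟨hxF, hx.2⟩
  · exact Or.inl ⟨hx.1, hxF⟩

lemma evalRef_mono {Φ : (Fin N → ℝ≥0) → ℝ≥0} (hΦ : Monotone Φ) {v w : Fin N → ℝ≥0∞}
    (hvw : ∀ i, v i ≤ w i) : evalRef Φ v ≤ evalRef Φ w := by
  unfold evalRef
  by_cases hw : ∀ i, w i ≠ ∞
  · rw [if_pos hw, if_pos fun i => ne_top_of_le_ne_top (hw i) (hvw i)]
    exact_mod_cast hΦ fun i => ENNReal.toNNReal_mono (hw i) (hvw i)
  · rw [if_neg hw]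
    exact le_top

lemma IsNSet.evalRef_cheeger_le {Φ : (Fin N → ℝ≥0) → ℝ≥0} (hΦ : Monotone Φ)
    {F : Set (EuclideanSpace ℝ (Fin d))} {E : Fin N → Set (EuclideanSpace ℝ (Fin d))}
    (hE : IsNSet F E) :
    evalRef Φ (fun i => cheeger (E i)) ≤ evalRef Φ (fun i => ratio (E i)) :=
  evalRef_mono hΦ fun i => cheeger_le_ratio (hE.measurable i) (by simp [AESubset]) (hE.pos i)

/-- Replacing every chamber by one of its Cheeger sets turns an `N`-set into an `N`-cluster. -/
lemma IsNSet.exists_isNCluster {Ω : Set (EuclideanSpace ℝ (Fin d))} (hΩ : MeasurableSet Ω)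
    (hΩfin : volume Ω ≠ ∞) {E : Fin N → Set (EuclideanSpace ℝ (Fin d))} (hE : IsNSet Ω E)
    (hfin : ∀ i, cheeger (E i) ≠ ∞) :
    ∃ G : Fin N → Set (EuclideanSpace ℝ (Fin d)), IsNCluster Ω G ∧
      ∀ i, ratio (G i) = cheeger (E i) := by
  choose G hG hGE hG0 hGP hGr using fun i =>
    exists_ratio_eq_cheeger hΩ hΩfin (hE.subset i) (hfin i)
  refine ⟨G, ⟨⟨hG, fun i => (hGE i).trans (hE.subset i), hG0, fun i j hij => ?_⟩, hGP⟩, hGr⟩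
  refine measure_mono_null (fun x hx => ?_)
    (measure_union_null (measure_union_null (hGE i) (hGE j)) (hE.disjoint i j hij))
  by_cases hi : x ∈ E i
  · by_cases hj : x ∈ E j
    · exact Or.inr ⟨hi, hj⟩
    · exact Or.inl (Or.inr ⟨hx.2, hj⟩)
  · exact Or.inl (Or.inl ⟨hx.1, hi⟩)

/-- The cluster of Cheeger sets gives `Φ` literally the same argument, so nothing is asked of `Φ`;
an `N`-set with an infinite Cheeger constant has value `∞`. -/
lemma cheegerConst_le_geomEigenvalue (Φ : (Fin N → ℝ≥0) → ℝ≥0)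
    {Ω : Set (EuclideanSpace ℝ (Fin d))} (hΩ : MeasurableSet Ω) (hΩfin : volume Ω ≠ ∞) :
    cheegerConst Φ Ω ≤ geomEigenvalue Φ Ω := by
  refine le_iInf fun E => le_iInf fun hE => ?_
  by_cases hfin : ∀ i, cheeger (E i) ≠ ∞
  · obtain ⟨G, hG, hGr⟩ := hE.exists_isNCluster hΩ hΩfin hfin
    refine iInf_le_of_le G (iInf_le_of_le hG ?_)
    simp only [hGr, le_refl]
  · rw [evalRef, if_neg hfin]
    exact le_top

lemma geomEigenvalue_le_cheegerConst {Φ : (Fin N → ℝ≥0) → ℝ≥0} (hΦ : Monotone Φ)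
    (Ω : Set (EuclideanSpace ℝ (Fin d))) : geomEigenvalue Φ Ω ≤ cheegerConst Φ Ω :=
  le_iInf fun E => le_iInf fun hE =>
    iInf_le_of_le E (iInf_le_of_le hE.toIsNSet (hE.toIsNSet.evalRef_cheeger_le hΦ))

end CheegerCluster

theorem mainTheorem3 {d N : ℕ} (Ω : Set (EuclideanSpace ℝ (Fin d)))
    (hΩ_nonempty : Ω.Nonempty) (hΩ_bounded : Bornology.IsBounded Ω) (hΩ_open : IsOpen Ω)
    (Φ : (Fin N → ℝ≥0) → ℝ≥0) :
    CheegerCluster.cheegerConst Φ Ω ≤ CheegerCluster.geomEigenvalue Φ Ω ∧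
    (Monotone Φ →
      CheegerCluster.geomEigenvalue Φ Ω = CheegerCluster.cheegerConst Φ Ω ∧
      ∀ E : Fin N → Set (EuclideanSpace ℝ (Fin d)),
        CheegerCluster.IsCheegerNCluster Φ Ω E → CheegerCluster.IsEigenNCluster Φ Ω E) := by
  have hle := CheegerCluster.cheegerConst_le_geomEigenvalue Φ hΩ_open.measurableSet
    hΩ_bounded.measure_lt_top.ne
  refine ⟨hle, fun hΦ => ?_⟩
  have heq := le_antisymm (CheegerCluster.geomEigenvalue_le_cheegerConst hΦ Ω) hle
  refine ⟨heq, fun E hE => ⟨⟨hE.1.toIsNSet, le_antisymm ?_ ?_⟩, hE.1⟩⟩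
  -- The value at the Cheeger constants is at most the value at the ratios, which is the common
  -- infimum.
  · rw [heq, ← hE.2]
    exact hE.1.toIsNSet.evalRef_cheeger_le hΦ
  · exact iInf_le_of_le E (iInf_le_of_le hE.1.toIsNSet le_rfl)
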